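/- Let $X$ be a finite set of cardinality $N$. An \emph{exponential family} $\mathcal E=\mathcal E_{\nu,T}$ on $X$ is given by a strictly positive measure $\nu$ on $X$ and a linear subspace $T\subseteq\mathbb R^X$ containing the constant functions; it is the set of all probability distributions $P_\vartheta(x)=\frac{\nu(x)}{Z_\vartheta}e^{\vartheta(x)}$, $\vartheta\in T$ (with $Z_\vartheta$ the normalization), and its dimension is $\dim T-1$. Its closure is denoted $\overline{\mathcal E}$. For probability distributions $P$ and $Q$ let $D(P\|Q)=\sum_{x}P(x)\log\frac{P(x)}{Q(x)}$, where $0\log 0=0\log(0/0)=0$ and $D(P\|Q)=+\infty$ if the support of $P$ is not contained in that of $Q$. Let $D(P\|\mathcal E)=\inf_{Q\in\mathcal E}D(P\|Q)$; $\max D(\cdot\|\mathcal E)$ is the maximum over all probability distributions $P$ on $X$. The \emph{partition exponential family} of a partition of $X$ is the exponential family with $\nu=1$ and $T$ the space of functions constant on each block of the partition; the \emph{partition model} of the partition is its closure. The \emph{mixture} of sets $M_1,\dots,M_c$ of probability distributions is $\{\sum_i\lambda_iP_i: P_i\in M_i,\ \lambda_i\ge 0,\ \sum_i\lambda_i=1\}$.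 Distributions on a subset of $X$ are regarded as distributions on $X$ by extending them by zero. \textbf{Theorem.} Let $\mathcal E$ be an exponential family on $X$ of dimension $\lceil N/2\rceil-1$ satisfying $\max D(\cdot\|\mathcal E)=\log 2$. (1) If $N$ is even, then $\mathcal E$ is a partition exponential family, and thus $\overline{\mathcal E}$ is a partition model. (2) If $N$ is odd, then there are a set $Z\subseteq X$ of cardinality three and a one-dimensional exponential family $\mathcal E_Z$ on $Z$ with $\max D(\cdot\|\mathcal E_Z)=\log 2$ such that: if $N=3$ (so that $Z=X$), then $\overline{\mathcal E}=\overline{\mathcal E_Z}$; and if $N>3$, then there is a partition exponential family $\mathcal E_{X\setminus Z}$ on $X\setminus Z$ with $\max D(\cdot\|\mathcal E_{X\setminus Z})=\log 2$ such that $\overline{\mathcal E}$ is the mixture of the partition model $\overline{\mathcal E_{X\setminus Z}}$ and $\overline{\mathcal E_Z}$. (3) If $\mathcal E$ contains the uniform distribution on $X$, then $\overline{\mathcal E}$ is a partition model. -/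

import Mathlib

/-- Data of an exponential family on a finite set `X`: a strictly positive reference measure `ν`
and an extended tangent space `T`, a linear subspace of `ℝ^X` containing the constants. -/
structure ExpFamily (X : Type*) where
  ν : X → ℝ
  ν_pos : ∀ x, 0 < ν x
  T : Submodule ℝ (X → ℝ)
  one_mem : (1 : X → ℝ) ∈ T

/-- The exponential family as a set of probability vectors: all
`P_θ(x) = ν(x) exp(θ(x)) / Z_θ` with `θ ∈ T`. -/
def ExpFamily.carrier {X : Type*} [Fintype X] (E : ExpFamily X) : Set (X → ℝ) :=
  {P | ∃ θ ∈ E.T,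
    P = fun x => E.ν x * Real.exp (θ x) / ∑ y, E.ν y * Real.exp (θ y)}

/-- The dimension of an exponential family, i.e. the dimension of its extended tangent space
modulo the constant functions. -/
noncomputable def ExpFamily.dim {X : Type*} (E : ExpFamily X) : ℤ :=
  (Module.finrank ℝ E.T : ℤ) - 1

/-- The information divergence `D(P‖Q)` of nonnegative vectors, with `0 log 0 = 0 log (0/0) = 0`,
and with the value `⊤` if the support of `P` is not contained in the support of `Q`. -/
noncomputable def infoDiv {X : Type*} [Fintype X] (P Q : X → ℝ) : EReal :=
  open Classical in
  if ∀ x, Q x = 0 → P x = 0 then ((∑ x, P x * Real.log (P x / Q x) : ℝ) : EReal) else ⊤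

/-- `D(P‖M) = inf_{Q ∈ M} D(P‖Q)`. -/
noncomputable def infoDivFrom {X : Type*} [Fintype X] (M : Set (X → ℝ)) (P : X → ℝ) : EReal :=
  ⨅ Q ∈ M, infoDiv P Q

/-- `max D(·‖M) = d`: the maximum over all probability distributions on `X` exists and is `d`. -/
def MaxInfoDivEq {X : Type*} [Fintype X] (M : Set (X → ℝ)) (d : ℝ) : Prop :=
  IsGreatest (infoDivFrom M '' stdSimplex ℝ X) (d : EReal)

/-- The partition exponential family of a partition of `X`, given by its equivalence relation:
uniform reference measure, and extended tangent space the functions constant on the blocks. -/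
def partitionFamily {X : Type*} (s : Setoid X) : ExpFamily X where
  ν := 1
  ν_pos := fun _ => one_pos
  T :=
    { carrier := {f | ∀ x y, s x y → f x = f y}
      add_mem' := fun {f g} hf hg x y h => by
        simp only [Pi.add_apply, hf x y h, hg x y h]
      zero_mem' := fun _ _ _ => rfl
      smul_mem' := fun c f hf x y h => by
        simp only [Pi.smul_apply, hf x y h] }
  one_mem := fun _ _ _ => rfl

/-- The partition model of a partition: the closure of its partition exponential family. -/
def partitionModel {X : Type*} [Fintype X] (s : Setoid X) : Set (X → ℝ) :=
  closure (partitionFamily s).carrier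

/-- The mixture of a finite family of sets of probability distributions. -/
def mixture {ι X : Type*} [Fintype ι] (M : ι → Set (X → ℝ)) : Set (X → ℝ) :=
  {P | ∃ (w : ι → ℝ) (Q : ι → X → ℝ), (∀ i, 0 ≤ w i) ∧ ∑ i, w i = 1 ∧ (∀ i, Q i ∈ M i) ∧
    P = ∑ i, w i • Q i}

/-- Distributions on a subset `Y ⊆ X`, regarded as distributions on `X` by extension by zero. -/
def extendByZero {X : Type*} {Y : Finset X} (M : Set (Y → ℝ)) : Set (X → ℝ) :=
  (fun P => Function.extend (Subtype.val : Y → X) P 0) '' M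

/-! Let `N` be the orthogonal complement of `T`. For `u ∈ N` with `∑ |u| = 2`, the positive and
negative parts of `u` are probability vectors. For `Q` in the family, their divergences from `Q` add
up to `2 log 2 + 2 D(|u|/2‖Q)`, and their difference does not depend on `Q`. The larger divergence
has infimum at most `log 2`, so `|u|/2` lies in the closure of the family
(`abs_div_two_mem_closure`). Taking logarithms gives `∑ v log |u| = ∑ v log ν` for every `v ∈ N`
supported inside `u` (`sum_mul_log_abs`). Apply this to the pencil `w - a u` with `g = w / u`: `∑ u
log |g - a| = 0` whenever `a` is not a value of `g`. As `a` tends to a value `c`, the logarithmic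
singularity forces `u` to sum to zero over `{g = c}` (`sum_fiber_eq_zero`). Hence every level set in
the support of `u` has at least two points. For `u` of maximal support and `w` separating as many
points as possible, each element of `N` is `u` times a function of `g`. The dimension hypothesis
then leaves no slack: `N` is spanned by the pieces of `u` on the level sets (`exists_labelling`).
All these levels are pairs, except possibly for one triple when the cardinality is odd. On a pair
`u` takes opposite values, so the relation reads `f x = f y`; this gives the partition structure. A
triple splits off as a mixture component, and it is incompatible with the uniform distribution
because `t log t` is strictly superadditive. -/

open Filter Topology

/-! ### Normal space and the logarithmic description of the family. -/

namespace ExpFamily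

/-- The normal space of an exponential family: the orthogonal complement of its extended tangent
space. -/
noncomputable def normalSpace {X : Type*} [Fintype X] (E : ExpFamily X) : Submodule ℝ (X → ℝ) :=
  LinearMap.BilinForm.orthogonal (dotProductBilin ℝ ℝ) E.T

end ExpFamily

section BilinForm

variable {X : Type*} [Fintype X]

lemma dotProductBilin_nondegenerate :
    LinearMap.BilinForm.Nondegenerate (dotProductBilin ℝ ℝ : LinearMap.BilinForm ℝ (X → ℝ)) := by
  classical
  refine (LinearMap.IsRefl.nondegenerate_iff_separatingLeft ?_).2 ?_
  · intro v w h
    simpa [dotProductBilin, dotProduct_comm] using h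
  · intro v hv
    exact dotProduct_eq_zero v hv

lemma dotProductBilin_isRefl :
    LinearMap.BilinForm.IsRefl (dotProductBilin ℝ ℝ : LinearMap.BilinForm ℝ (X → ℝ)) := by
  intro v w h
  simpa [dotProductBilin, dotProduct_comm] using h

end BilinForm

namespace ExpFamily

variable {X : Type*} [Fintype X] {E : ExpFamily X}

lemma mem_normalSpace {v : X → ℝ} : v ∈ E.normalSpace ↔ ∀ f ∈ E.T, ∑ x, v x * f x = 0 := by
  simp only [normalSpace, LinearMap.BilinForm.mem_orthogonal_iff]
  refine forall₂_congr fun f _ => ?_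
  simp [dotProductBilin, dotProduct, mul_comm]

lemma mem_T_iff {f : X → ℝ} : f ∈ E.T ↔ ∀ v ∈ E.normalSpace, ∑ x, v x * f x = 0 := by
  conv_lhs => rw [← LinearMap.BilinForm.orthogonal_orthogonal dotProductBilin_nondegenerate
    dotProductBilin_isRefl E.T]
  rw [LinearMap.BilinForm.mem_orthogonal_iff]
  exact forall₂_congr fun v _ => by simp [dotProductBilin, dotProduct]

lemma finrank_normalSpace :
    Module.finrank ℝ E.normalSpace = Fintype.card X - Module.finrank ℝ E.T := by
  rw [normalSpace, LinearMap.BilinForm.finrank_orthogonal dotProductBilin_nondegenerate]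
  simp

lemma sum_eq_zero_of_mem_normalSpace {v : X → ℝ} (hv : v ∈ E.normalSpace) : ∑ x, v x = 0 := by
  simpa using mem_normalSpace.1 hv 1 E.one_mem

lemma partition_pos (E : ExpFamily X) (θ : X → ℝ) (x : X) :
    0 < ∑ y, E.ν y * Real.exp (θ y) :=
  Finset.sum_pos (fun y _ => mul_pos (E.ν_pos y) (Real.exp_pos _)) ⟨x, Finset.mem_univ x⟩

lemma pos_of_mem_carrier {Q : X → ℝ} (hQ : Q ∈ E.carrier) (x : X) : 0 < Q x := by
  obtain ⟨θ, -, rfl⟩ := hQ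
  exact div_pos (mul_pos (E.ν_pos x) (Real.exp_pos _)) (E.partition_pos θ x)

lemma sum_of_mem_carrier [Nonempty X] {Q : X → ℝ} (hQ : Q ∈ E.carrier) : ∑ x, Q x = 1 := by
  obtain ⟨θ, -, rfl⟩ := hQ
  rw [← Finset.sum_div, div_self (E.partition_pos θ (Classical.arbitrary X)).ne']

lemma log_sub_log_mem {Q : X → ℝ} (hQ : Q ∈ E.carrier) :
    (fun x => Real.log (Q x) - Real.log (E.ν x)) ∈ E.T := by
  obtain ⟨θ, hθ, rfl⟩ := hQ
  convert E.T.sub_mem hθ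
    (E.T.smul_mem (Real.log (∑ y, E.ν y * Real.exp (θ y))) E.one_mem) using 1
  ext x
  have h1 := E.partition_pos θ x
  have h2 := E.ν_pos x
  rw [Real.log_div (by positivity) h1.ne', Real.log_mul h2.ne' (Real.exp_pos _).ne', Real.log_exp]
  simp only [Pi.sub_apply, Pi.smul_apply, Pi.one_apply, smul_eq_mul]
  ring

lemma mem_carrier_of_log_sub_log_mem {Q : X → ℝ} (hpos : ∀ x, 0 < Q x) (hsum : ∑ x, Q x = 1)
    (h : (fun x => Real.log (Q x) - Real.log (E.ν x)) ∈ E.T) : Q ∈ E.carrier := by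
  refine ⟨_, h, ?_⟩
  have key : ∀ x, E.ν x * Real.exp (Real.log (Q x) - Real.log (E.ν x)) = Q x := by
    intro x
    rw [Real.exp_sub, Real.exp_log (hpos x), Real.exp_log (E.ν_pos x),
      mul_div_cancel₀ _ (E.ν_pos x).ne']
  simp only [key, hsum, div_one]

lemma mem_carrier_iff [Nonempty X] {Q : X → ℝ} : Q ∈ E.carrier ↔
    (∀ x, 0 < Q x) ∧ ∑ x, Q x = 1 ∧ (fun x => Real.log (Q x) - Real.log (E.ν x)) ∈ E.T :=
  ⟨fun h => ⟨pos_of_mem_carrier h, sum_of_mem_carrier h, log_sub_log_mem h⟩,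
    fun h => mem_carrier_of_log_sub_log_mem h.1 h.2.1 h.2.2⟩

lemma sum_mul_log_of_mem_carrier {Q v : X → ℝ} (hQ : Q ∈ E.carrier) (hv : v ∈ E.normalSpace) :
    ∑ x, v x * Real.log (Q x) = ∑ x, v x * Real.log (E.ν x) := by
  have := mem_normalSpace.1 hv _ (log_sub_log_mem hQ)
  simp only [mul_sub, Finset.sum_sub_distrib] at this
  linarith

end ExpFamily

/-! ### Relative entropy: Hellinger bound and identities for positive and negative parts. -/

section RelEnt

variable {X : Type*} [Fintype X]

/-- The real-valued relative entropy, which agrees with `infoDiv` when `Q` is positive. -/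
noncomputable def relEnt (P Q : X → ℝ) : ℝ := ∑ x, P x * Real.log (P x / Q x)

lemma infoDiv_eq_relEnt {P Q : X → ℝ} (hQ : ∀ x, 0 < Q x) : infoDiv P Q = (relEnt P Q : EReal) := by
  rw [infoDiv, if_pos fun x hx => absurd hx (hQ x).ne', relEnt]

/-- This is `t + 1 ≤ exp t` at `t = -log √(p/q)`, multiplied by `p`. The correction `q - p` cancels
after summing over vectors of equal mass. -/
lemma hellinger_le_mul_log {p q : ℝ} (hp : 0 ≤ p) (hq : 0 < q) :
    (√p - √q) ^ 2 ≤ p * Real.log (p / q) + (q - p) := by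
  rcases hp.eq_or_lt with rfl | hp
  · simp [Real.sq_sqrt hq.le]
  have h1 := Real.add_one_le_exp (-Real.log √(p / q))
  have h2 : Real.exp (-Real.log √(p / q)) = √q / √p := by
    rw [Real.exp_neg, Real.exp_log (Real.sqrt_pos.2 (div_pos hp hq)), Real.sqrt_div hp.le, inv_div]
  rw [h2, Real.log_sqrt (div_pos hp hq).le] at h1
  have hp' := Real.sqrt_pos.2 hp
  have h3 : p * (√q / √p) = √p * √q := by
    nth_rewrite 1 [← Real.mul_self_sqrt hp.le]
    field_simp
  have h4 := mul_le_mul_of_nonneg_left h1 hp.le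
  rw [h3] at h4
  have h5 := Real.sq_sqrt hp.le
  have h6 := Real.sq_sqrt hq.le
  nlinarith

lemma sum_hellinger_le_relEnt {P Q : X → ℝ} (hP : ∀ x, 0 ≤ P x) (hQ : ∀ x, 0 < Q x)
    (h : ∑ x, P x = ∑ x, Q x) : ∑ x, (√(P x) - √(Q x)) ^ 2 ≤ relEnt P Q := by
  calc _ ≤ ∑ x, (P x * Real.log (P x / Q x) + (Q x - P x)) :=
        Finset.sum_le_sum fun x _ => hellinger_le_mul_log (hP x) (hQ x)
    _ = relEnt P Q := by
        rw [Finset.sum_add_distrib, Finset.sum_sub_distrib, h, sub_self, add_zero, relEnt]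

lemma relEnt_nonneg {P Q : X → ℝ} (hP : ∀ x, 0 ≤ P x) (hQ : ∀ x, 0 < Q x)
    (h : ∑ x, P x = ∑ x, Q x) : 0 ≤ relEnt P Q :=
  (Finset.sum_nonneg fun _ _ => sq_nonneg _).trans (sum_hellinger_le_relEnt hP hQ h)

/-- A crude Pinsker inequality, used to turn small divergence into closeness: factor `P - Q` as a
difference of squares of roots, where the sum of the roots is at most 2. -/
lemma sq_sub_le_four_mul_relEnt {P Q : X → ℝ} (hP : ∀ x, 0 ≤ P x) (hQ : ∀ x, 0 < Q x)
    (hP1 : ∑ x, P x = 1) (hQ1 : ∑ x, Q x = 1) (x : X) : (P x - Q x) ^ 2 ≤ 4 * relEnt P Q := by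
  have h1 : (√(P x) - √(Q x)) ^ 2 ≤ relEnt P Q :=
    (Finset.single_le_sum (f := fun x => (√(P x) - √(Q x)) ^ 2) (fun _ _ => sq_nonneg _)
      (Finset.mem_univ x)).trans (sum_hellinger_le_relEnt hP hQ (hP1.trans hQ1.symm))
  have h2 : P x ≤ 1 := hP1 ▸ Finset.single_le_sum (fun y _ => hP y) (Finset.mem_univ x)
  have h3 : Q x ≤ 1 := hQ1 ▸ Finset.single_le_sum (fun y _ => (hQ y).le) (Finset.mem_univ x)
  have h4 : (√(P x) + √(Q x)) ^ 2 ≤ 2 ^ 2 := by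
    have := Real.sqrt_le_one.2 h2
    have := Real.sqrt_le_one.2 h3
    gcongr
    linarith
  have h5 : P x - Q x = (√(P x) - √(Q x)) * (√(P x) + √(Q x)) := by
    nlinarith [Real.sq_sqrt (hP x), Real.sq_sqrt (hQ x).le]
  rw [h5, mul_pow]
  nlinarith [sq_nonneg (√(P x) - √(Q x))]

/-- The two parts have disjoint supports, so the left side is the sum of `|u| log (|u|/Q)`; halving
`|u|` inside the logarithm costs `log 2` per unit of mass. -/
lemma relEnt_max_add_relEnt_max (u : X → ℝ) {Q : X → ℝ} (hQ : ∀ x, 0 < Q x)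
    (hu : ∑ x, |u x| = 2) :
    relEnt (fun x => max (u x) 0) Q + relEnt (fun x => max (-u x) 0) Q =
      2 * Real.log 2 + 2 * relEnt (fun x => |u x| / 2) Q := by
  have h2 : 2 * Real.log 2 = ∑ x, |u x| * Real.log 2 := by rw [← Finset.sum_mul, hu]
  rw [relEnt, relEnt, relEnt, h2, Finset.mul_sum, ← Finset.sum_add_distrib,
    ← Finset.sum_add_distrib]
  refine Finset.sum_congr rfl fun x _ => ?_
  rcases lt_trichotomy (u x) 0 with h | h | h
  · rw [max_eq_right h.le, max_eq_left (by linarith), abs_of_neg h, div_right_comm (-u x),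
      Real.log_div (div_pos (by linarith) (hQ x)).ne' two_ne_zero]
    ring
  · simp [h]
  · rw [max_eq_left h.le, max_eq_right (by linarith), abs_of_pos h, div_right_comm (u x),
      Real.log_div (div_pos h (hQ x)).ne' two_ne_zero]
    ring

/-- The dependence on `Q` is only through `∑ u log Q`, which is constant on the family when `u` is
normal. -/
lemma relEnt_max_sub_relEnt_max (u : X → ℝ) {Q : X → ℝ} (hQ : ∀ x, 0 < Q x) :
    relEnt (fun x => max (u x) 0) Q - relEnt (fun x => max (-u x) 0) Q =
      ∑ x, u x * Real.log |u x| - ∑ x, u x * Real.log (Q x) := by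
  rw [relEnt, relEnt, ← Finset.sum_sub_distrib, ← Finset.sum_sub_distrib]
  refine Finset.sum_congr rfl fun x _ => ?_
  rcases lt_trichotomy (u x) 0 with h | h | h
  · rw [max_eq_right h.le, max_eq_left (by linarith), abs_of_neg h,
      Real.log_div (neg_pos.2 h).ne' (hQ x).ne']
    ring
  · simp [h]
  · rw [max_eq_left h.le, max_eq_right (by linarith), abs_of_pos h,
      Real.log_div h.ne' (hQ x).ne']
    ring

lemma max_mem_stdSimplex {u : X → ℝ} (h0 : ∑ x, u x = 0) (h2 : ∑ x, |u x| = 2) :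
    (fun x => max (u x) 0) ∈ stdSimplex ℝ X := by
  refine ⟨fun x => le_max_right _ _, ?_⟩
  have : ∀ x, max (u x) 0 = (u x + |u x|) / 2 := fun x => by
    rcases le_total (u x) 0 with h | h
    · rw [max_eq_right h, abs_of_nonpos h]; ring
    · rw [max_eq_left h, abs_of_nonneg h]; ring
  simp only [this]
  rw [← Finset.sum_div, Finset.sum_add_distrib, h0, h2]
  norm_num

end RelEnt

/-! ### Consequences of the bound `log 2` for normal vectors. -/

namespace ExpFamily

variable {X : Type*} [Fintype X] {E : ExpFamily X}

/-- By `hs` the positive part has the larger divergence, so adding the two identities gives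
`D(|u|/2‖Q) ≤ D(u⁺‖Q) - log 2`, which can be made arbitrarily small. -/
lemma abs_div_two_mem_closure_aux
    (hE : ∀ P ∈ stdSimplex ℝ X, infoDivFrom E.carrier P ≤ (Real.log 2 : EReal))
    {u : X → ℝ} (hu : u ∈ E.normalSpace) (h2 : ∑ x, |u x| = 2)
    (hs : ∑ x, u x * Real.log (E.ν x) ≤ ∑ x, u x * Real.log |u x|) :
    (fun x => |u x| / 2) ∈ closure E.carrier := by
  have h0 := sum_eq_zero_of_mem_normalSpace hu
  have : Nonempty X := by
    by_contra h
    rw [not_nonempty_iff] at h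
    simp at h2
  rw [Metric.mem_closure_iff]
  intro ε hε
  -- The slack `ε ^ 2 / 4` matches the constant 4 in `sq_sub_le_four_mul_relEnt`.
  have hlt : infoDivFrom E.carrier (fun x => max (u x) 0) < ((Real.log 2 + ε ^ 2 / 4 : ℝ) : EReal) :=
    (hE _ (max_mem_stdSimplex h0 h2)).trans_lt (by
      exact_mod_cast lt_add_of_pos_right _ (by positivity))
  rw [infoDivFrom] at hlt
  simp only [iInf_lt_iff] at hlt
  obtain ⟨Q, hQ, hlt⟩ := hlt
  have hQpos := pos_of_mem_carrier hQ
  rw [infoDiv_eq_relEnt hQpos, EReal.coe_lt_coe_iff] at hlt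
  have e1 := relEnt_max_add_relEnt_max u hQpos h2
  have e2 := relEnt_max_sub_relEnt_max u hQpos
  rw [sum_mul_log_of_mem_carrier hQ hu] at e2
  refine ⟨Q, hQ, (dist_pi_lt_iff hε).2 fun x => ?_⟩
  have h3 := sq_sub_le_four_mul_relEnt (P := fun x => |u x| / 2) (fun x => by positivity) hQpos
    (by rw [← Finset.sum_div, h2]; norm_num) (sum_of_mem_carrier hQ) x
  rw [Real.dist_eq]
  exact abs_lt_of_sq_lt_sq (by linarith) hε.le

/-- If the divergence is bounded by `log 2`, the modulus of a normal vector belongs to the closure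
of the family after normalization. -/
lemma abs_div_two_mem_closure
    (hE : ∀ P ∈ stdSimplex ℝ X, infoDivFrom E.carrier P ≤ (Real.log 2 : EReal))
    {u : X → ℝ} (hu : u ∈ E.normalSpace) (h2 : ∑ x, |u x| = 2) :
    (fun x => |u x| / 2) ∈ closure E.carrier := by
  rcases le_total (∑ x, u x * Real.log (E.ν x)) (∑ x, u x * Real.log |u x|) with h | h
  · exact abs_div_two_mem_closure_aux hE hu h2 h
  · simpa using abs_div_two_mem_closure_aux hE (neg_mem hu) (by simpa using h2) (by simpa using h)

/-- The same identities read from below: `D(|u|/2‖Q) ≥ 0` forces the divergence of the positive part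
to be at least `log 2`. -/
lemma maxInfoDivEq_aux
    (hE : ∀ P ∈ stdSimplex ℝ X, infoDivFrom E.carrier P ≤ (Real.log 2 : EReal))
    {u : X → ℝ} (hu : u ∈ E.normalSpace) (h2 : ∑ x, |u x| = 2)
    (hs : ∑ x, u x * Real.log (E.ν x) ≤ ∑ x, u x * Real.log |u x|) :
    MaxInfoDivEq E.carrier (Real.log 2) := by
  have h0 := sum_eq_zero_of_mem_normalSpace hu
  have : Nonempty X := by
    by_contra h
    rw [not_nonempty_iff] at h
    simp at h2
  refine ⟨⟨_, max_mem_stdSimplex h0 h2, le_antisymm (hE _ (max_mem_stdSimplex h0 h2)) ?_⟩, ?_⟩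
  · refine le_iInf₂ fun Q hQ => ?_
    have hQpos := pos_of_mem_carrier hQ
    rw [infoDiv_eq_relEnt hQpos, EReal.coe_le_coe_iff]
    have e1 := relEnt_max_add_relEnt_max u hQpos h2
    have e2 := relEnt_max_sub_relEnt_max u hQpos
    rw [sum_mul_log_of_mem_carrier hQ hu] at e2
    have e3 := relEnt_nonneg (P := fun x => |u x| / 2) (fun x => by positivity) hQpos
      (by rw [← Finset.sum_div, h2, sum_of_mem_carrier hQ]; norm_num)
    linarith
  · rintro _ ⟨P, hP, rfl⟩
    exact hE P hP

lemma sum_abs_pos {u : X → ℝ} (h : u ≠ 0) : 0 < ∑ x, |u x| := by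
  obtain ⟨x, hx⟩ := Function.ne_iff.1 h
  exact Finset.sum_pos' (fun _ _ => abs_nonneg _) ⟨x, Finset.mem_univ x, abs_pos.2 hx⟩

lemma sum_abs_smul_eq_two {u : X → ℝ} (h : u ≠ 0) :
    ∑ x, |((2 / ∑ y, |u y|) • u) x| = 2 := by
  have := sum_abs_pos h
  simp only [Pi.smul_apply, smul_eq_mul, abs_mul, abs_of_pos (div_pos two_pos this)]
  rw [← Finset.mul_sum]
  field_simp

/-- If the divergence is bounded by `log 2` and the family is not the full simplex, then the
bound is attained. -/
lemma maxInfoDivEq_log_two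
    (hE : ∀ P ∈ stdSimplex ℝ X, infoDivFrom E.carrier P ≤ (Real.log 2 : EReal))
    {u : X → ℝ} (hu : u ∈ E.normalSpace) (h : u ≠ 0) :
    MaxInfoDivEq E.carrier (Real.log 2) := by
  have hv := E.normalSpace.smul_mem (2 / ∑ y, |u y|) hu
  have h2 := sum_abs_smul_eq_two h
  set v := (2 / ∑ y, |u y|) • u
  rcases le_total (∑ x, v x * Real.log (E.ν x)) (∑ x, v x * Real.log |v x|) with h | h
  · exact maxInfoDivEq_aux hE hv h2 h
  · exact maxInfoDivEq_aux hE (neg_mem hv) (by simpa using h2) (by simpa using h)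

/-- The log-linear equations pass to limits because `log` is continuous at every coordinate that `v`
sees. -/
lemma sum_mul_log_of_mem_closure {P v : X → ℝ} (hP : P ∈ closure E.carrier)
    (hv : v ∈ E.normalSpace) (hPv : ∀ x, v x ≠ 0 → P x ≠ 0) :
    ∑ x, v x * Real.log (P x) = ∑ x, v x * Real.log (E.ν x) := by
  obtain ⟨Q, hQ, hlim⟩ := mem_closure_iff_seq_limit.1 hP
  have h1 : Tendsto (fun n => ∑ x, v x * Real.log (Q n x)) atTop
      (𝓝 (∑ x, v x * Real.log (P x))) := by
    refine tendsto_finsetSum _ fun x _ => ?_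
    by_cases hx : v x = 0
    · simp [hx]
    · exact ((tendsto_pi_nhds.1 hlim x).log (hPv x hx)).const_mul _
  simp only [fun n => sum_mul_log_of_mem_carrier (hQ n) hv] at h1
  exact tendsto_nhds_unique h1 tendsto_const_nhds |>.symm ▸ rfl

/-- Apply the closure equations to `|u|` normalized; the normalizing constant drops out since `v`
sums to zero. -/
lemma sum_mul_log_abs
    (hE : ∀ P ∈ stdSimplex ℝ X, infoDivFrom E.carrier P ≤ (Real.log 2 : EReal))
    {u v : X → ℝ} (hu : u ∈ E.normalSpace) (hv : v ∈ E.normalSpace)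
    (huv : ∀ x, v x ≠ 0 → u x ≠ 0) :
    ∑ x, v x * Real.log |u x| = ∑ x, v x * Real.log (E.ν x) := by
  by_cases h : u = 0
  · have : v = 0 := by
      ext x
      by_contra hx
      exact huv x hx (by simp [h])
    simp [this]
  have hS := sum_abs_pos h
  have hP := abs_div_two_mem_closure hE (E.normalSpace.smul_mem (2 / ∑ y, |u y|) hu)
    (sum_abs_smul_eq_two h)
  have key : ∀ x, |((2 / ∑ y, |u y|) • u) x| / 2 = |u x| / ∑ y, |u y| := by
    intro x
    rw [Pi.smul_apply, smul_eq_mul, abs_mul, abs_of_pos (div_pos two_pos hS)]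
    field_simp
  simp only [key] at hP
  rw [← sum_mul_log_of_mem_closure hP hv
    fun x hx => div_ne_zero (abs_ne_zero.2 (huv x hx)) hS.ne']
  have : ∀ x, v x * Real.log (|u x| / ∑ y, |u y|) =
      v x * Real.log |u x| - v x * Real.log (∑ y, |u y|) := by
    intro x
    by_cases hx : v x = 0
    · simp [hx]
    · rw [Real.log_div (abs_ne_zero.2 (huv x hx)) hS.ne', mul_sub]
  simp only [this]
  rw [Finset.sum_sub_distrib, ← Finset.sum_mul, sum_eq_zero_of_mem_normalSpace hv, zero_mul,
    sub_zero]

/-- The entries of a normal vector sum to zero over each level set of the ratio of two normal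
vectors. -/
lemma sum_fiber_eq_zero
    (hE : ∀ P ∈ stdSimplex ℝ X, infoDivFrom E.carrier P ≤ (Real.log 2 : EReal))
    {u w : X → ℝ} (hu : u ∈ E.normalSpace) (hw : w ∈ E.normalSpace)
    (huw : ∀ x, w x ≠ 0 → u x ≠ 0) (c : ℝ) :
    ∑ x with w x / u x = c, u x = 0 := by
  set g : X → ℝ := fun x => w x / u x with hg
  have hwg : ∀ x, w x = u x * g x := by
    intro x
    by_cases hx : u x = 0
    · have : w x = 0 := by
        by_contra h
        exact huw x h hx
      simp [hx, this]
    · simp only [hg]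
      field_simp
  -- Subtract the identities of `sum_mul_log_abs` for `w - a u` and for `u`, both tested against
  -- `u`.
  have h1 : ∀ a, (∀ x, g x ≠ a) → ∑ x, u x * Real.log |g x - a| = 0 := by
    intro a ha
    have hmem : w - a • u ∈ E.normalSpace := sub_mem hw (E.normalSpace.smul_mem a hu)
    have hval : ∀ x, (w - a • u) x = u x * (g x - a) := by
      intro x
      simp only [Pi.sub_apply, Pi.smul_apply, smul_eq_mul, hwg]
      ring
    have e1 := sum_mul_log_abs hE hmem hu fun x hx => by
      rw [hval]
      exact mul_ne_zero hx (sub_ne_zero.2 (ha x))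
    have e2 := sum_mul_log_abs hE hu hu fun x hx => hx
    have e3 : ∀ x, u x * Real.log |(w - a • u) x| =
        u x * Real.log |u x| + u x * Real.log |g x - a| := by
      intro x
      by_cases hx : u x = 0
      · simp [hx]
      · rw [hval, abs_mul, Real.log_mul (abs_ne_zero.2 hx)
          (abs_ne_zero.2 (sub_ne_zero.2 (ha x))), mul_add]
    simp only [e3] at e1
    rw [Finset.sum_add_distrib] at e1
    linarith
  have h2 : ∀ᶠ a in 𝓝[≠] c, ∀ x, g x ≠ a := by
    rw [eventually_all]
    intro x
    by_cases hx : g x = c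
    · filter_upwards [self_mem_nhdsWithin] with a ha
      rw [hx]
      exact fun h => ha h.symm
    · exact nhdsWithin_le_nhds
        ((eventually_ne_nhds (Ne.symm hx)).mono fun a ha => Ne.symm ha)
  by_contra hne
  set U := ∑ x with g x = c, u x with hU
  -- If `U ≠ 0`, the relation can be solved for `log (c - a)`: the right side converges as `a → c`
  -- while the left side diverges. `Real.log` ignores signs, so both sides of `c` are allowed.
  have h3 : ∀ᶠ a in 𝓝[≠] c, Real.log (c - a) =
      -(∑ x with g x ≠ c, u x * Real.log |g x - a|) / U := by
    filter_upwards [h2] with a ha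
    have := h1 a ha
    rw [← Finset.sum_filter_add_sum_filter_not _ (fun x => g x = c)] at this
    have e : ∑ x with g x = c, u x * Real.log |g x - a| = U * Real.log (c - a) := by
      rw [hU, Finset.sum_mul]
      refine Finset.sum_congr rfl fun x hx => ?_
      rw [(Finset.mem_filter.1 hx).2, Real.log_abs]
    rw [e] at this
    field_simp
    linarith
  have h4 : Tendsto (fun a => -(∑ x with g x ≠ c, u x * Real.log |g x - a|) / U) (𝓝[≠] c)
      (𝓝 (-(∑ x with g x ≠ c, u x * Real.log |g x - c|) / U)) := by
    refine ((tendsto_finsetSum _ fun x hx => ?_).neg).div_const U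
    have hx := (Finset.mem_filter.1 hx).2
    refine Tendsto.const_mul _ (Tendsto.log ?_ (abs_ne_zero.2 (sub_ne_zero.2 hx)))
    have : Continuous fun a => |g x - a| := by fun_prop
    exact (this.tendsto c).mono_left nhdsWithin_le_nhds
  have h5 : Tendsto (fun a => Real.log (c - a)) (𝓝[≠] c) atBot := by
    refine Real.tendsto_log_nhdsNE_zero.comp ?_
    refine tendsto_nhdsWithin_of_tendsto_nhds_of_eventually_within _ ?_ ?_
    · have : Continuous fun a => c - a := by fun_prop
      simpa using (this.tendsto c).mono_left (nhdsWithin_le_nhds (s := {c}ᶜ))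
    · filter_upwards [self_mem_nhdsWithin] with a ha
      exact sub_ne_zero.2 (Ne.symm ha)
  exact not_tendsto_nhds_of_tendsto_atBot h5 _ (h4.congr' (h3.mono fun _ h => h.symm))

end ExpFamily

/-! ### Generic normal vectors and the structure of the tangent space. -/

namespace ExpFamily

variable {X : Type*} [Fintype X] {E : ExpFamily X}

/-- A real vector space is not a finite union of proper subspaces, so one vector avoids the kernels
of all coordinates that are nonzero on `K`. -/
lemma exists_generic (K : Submodule ℝ (X → ℝ)) :
    ∃ u ∈ K, ∀ v ∈ K, ∀ x, v x ≠ 0 → u x ≠ 0 := by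
  obtain ⟨u, hu, h⟩ := Module.Dual.exists_forall_mem_ne_zero_of_forall_exists K
    (fun x : {x : X // ∃ v ∈ K, v x ≠ 0} => (LinearMap.proj x.1 : (X → ℝ) →ₗ[ℝ] ℝ))
    (fun x => x.2)
  exact ⟨u, hu, fun v hv x hx => h ⟨x, v, hv, hx⟩⟩

/-- The same avoidance argument, for the functionals `v ↦ v x / u x - v y / u y`. It makes every
ratio `v / u` a function of `w / u`. -/
lemma exists_separating (K : Submodule ℝ (X → ℝ)) (u : X → ℝ) :
    ∃ w ∈ K, ∀ v ∈ K, ∀ x y, w x / u x = w y / u y → v x / u x = v y / u y := by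
  obtain ⟨w, hw, h⟩ := Module.Dual.exists_forall_mem_ne_zero_of_forall_exists K
    (fun p : {p : X × X // ∃ v ∈ K, v p.1 / u p.1 ≠ v p.2 / u p.2} =>
      ((u p.1.1)⁻¹ • LinearMap.proj p.1.1 - (u p.1.2)⁻¹ • LinearMap.proj p.1.2 :
        (X → ℝ) →ₗ[ℝ] ℝ))
    (fun p => by
      obtain ⟨v, hv, h⟩ := p.2
      refine ⟨v, hv, ?_⟩
      simpa [div_eq_inv_mul, sub_eq_zero] using h)
  refine ⟨w, hw, fun v hv x y hxy => ?_⟩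
  by_contra hne
  apply h ⟨(x, y), v, hv, hne⟩
  simpa [div_eq_inv_mul, sub_eq_zero] using hxy

/-- If the entries of `u` sum to zero over each level set of `g`, then each level set within the
support of `u` has at least two elements. -/
lemma two_le_card_fiber {u g : X → ℝ} (h : ∀ c, ∑ x with g x = c, u x = 0) {c : ℝ}
    (hc : c ∈ (Finset.univ.filter fun x => u x ≠ 0).image g) :
    2 ≤ ((Finset.univ.filter fun x => u x ≠ 0).filter fun x => g x = c).card := by
  obtain ⟨x, hx, rfl⟩ := Finset.mem_image.1 hc
  by_contra! hlt
  have hx' : x ∈ (Finset.univ.filter fun x => u x ≠ 0).filter fun y => g y = g x := by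
    simpa using hx
  have h1 := h (g x)
  rw [Finset.sum_eq_single x] at h1
  · exact (Finset.mem_filter.1 hx).2 h1
  · intro y hy hyx
    by_contra hy0
    refine hyx (Finset.card_le_one.1 (Nat.lt_succ_iff.1 hlt) y ?_ x hx')
    simpa [hy0] using hy
  · simp

/-- Structure of the families of minimal dimension with divergence bounded by `log 2`. -/
lemma exists_labelling
    (hE : ∀ P ∈ stdSimplex ℝ X, infoDivFrom E.carrier P ≤ (Real.log 2 : EReal))
    (hdim : Fintype.card X ≤ 2 * Module.finrank ℝ E.normalSpace + 1) :
    ∃ u g : X → ℝ, (∀ f, f ∈ E.T ↔ ∀ c, ∑ x with g x = c, u x * f x = 0) ∧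
      (fun x => Real.log |u x| - Real.log (E.ν x)) ∈ E.T ∧
      Fintype.card X ≤ 2 * ((Finset.univ.filter fun x => u x ≠ 0).image g).card + 1 := by
  obtain ⟨u, hu, hgen⟩ := exists_generic E.normalSpace
  obtain ⟨w, hw, hsep⟩ := exists_separating E.normalSpace u
  -- Outside the support of `u`, division by zero gives the label 0; this is harmless, as every
  -- relation weights such points by `u x = 0`.
  set g : X → ℝ := fun x => w x / u x with hg
  have hfib : ∀ c, ∑ x with g x = c, u x = 0 := sum_fiber_eq_zero hE hu hw (hgen w hw)
  have hcard := Finset.mul_card_image_le_card (Finset.univ.filter fun x => u x ≠ 0) (f := g) 2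
    fun c hc => two_le_card_fiber hfib hc
  have hcard' := Finset.card_le_univ (Finset.univ.filter fun x => u x ≠ 0)
  set S := (Finset.univ.filter fun x => u x ≠ 0).image g with hS
  have hr : ∀ c : S, ∃ x, u x ≠ 0 ∧ g x = c := by
    rintro ⟨c, hc⟩
    simpa [hS] using hc
  choose r hru hrg using hr
  have hval : ∀ v ∈ E.normalSpace, ∀ x y, u y ≠ 0 → g x = g y → v x = u x * (v y / u y) := by
    intro v hv x y hy hxy
    by_cases hx : u x = 0
    · rw [hx, zero_mul]
      by_contra hvx
      exact hgen v hv x hvx hx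
    · rw [← hsep v hv x y hxy, mul_div_cancel₀ _ hx]
  -- A normal vector is determined by its values at one representative per level, so its space has
  -- dimension at most `S.card`. Conversely `2 * S.card` is at most the cardinality of `X`, so
  -- `hdim` forces equality and `Φ` is also onto.
  let Φ : E.normalSpace →ₗ[ℝ] (S → ℝ) := (LinearMap.funLeft ℝ ℝ r) ∘ₗ E.normalSpace.subtype
  have hinj : Function.Injective Φ := by
    rw [← LinearMap.ker_eq_bot, LinearMap.ker_eq_bot']
    rintro ⟨v, hv⟩ h0
    ext x
    by_contra hx
    have hux := hgen v hv x hx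
    have hc : g x ∈ S := Finset.mem_image_of_mem _ (by simpa using hux)
    have h1 := hval v hv x (r ⟨g x, hc⟩) (hru _) (hrg ⟨g x, _⟩).symm
    have h2 : v (r ⟨g x, hc⟩) = 0 := congrFun h0 ⟨g x, hc⟩
    rw [h2, zero_div, mul_zero] at h1
    exact hx h1
  have hle := LinearMap.finrank_le_finrank_of_injective hinj
  have hfr : Module.finrank ℝ (S → ℝ) = S.card := by simp
  rw [hfr] at hle
  have hsurj : Function.Surjective Φ := by
    rw [← LinearMap.injective_iff_surjective_of_finrank_eq_finrank]
    · exact hinj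
    · omega
  refine ⟨u, g, fun f => ⟨fun hf c => ?_, fun hf => mem_T_iff.2 fun v hv => ?_⟩,
    mem_T_iff.2 fun v hv => ?_, by rw [← hS]; omega⟩
  · by_cases hc : c ∈ S
    -- The preimage `v` agrees with `u` on level `c` and vanishes elsewhere.
    · obtain ⟨⟨v, hv⟩, h⟩ := hsurj (Pi.single ⟨c, hc⟩ (u (r ⟨c, hc⟩)))
      have h1 := mem_normalSpace.1 hv f hf
      rw [← h1, Finset.sum_filter]
      refine Finset.sum_congr rfl fun x _ => ?_
      by_cases hux : u x = 0
      · have : v x = 0 := by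
          by_contra hvx
          exact hgen v hv x hvx hux
        simp [hux, this]
      have hcx : g x ∈ S := Finset.mem_image_of_mem _ (by simpa using hux)
      have h2 := hval v hv x (r ⟨g x, hcx⟩) (hru _) (hrg ⟨g x, _⟩).symm
      have h3 : v (r ⟨g x, hcx⟩) = _ := congrFun h ⟨g x, hcx⟩
      split_ifs with hgx
      · subst hgx
        rw [Pi.single_eq_same] at h3
        rw [h2, h3, div_self (hru _), mul_one]
      · rw [Pi.single_eq_of_ne (by simpa [Subtype.ext_iff] using hgx)] at h3
        rw [h2, h3]
        simp
    · refine Finset.sum_eq_zero fun x hx => ?_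
      have : u x = 0 := by
        by_contra hux
        exact hc ((Finset.mem_filter.1 hx).2 ▸ Finset.mem_image_of_mem _ (by simpa using hux))
      rw [this, zero_mul]
  · rw [← Finset.sum_fiberwise_of_maps_to (t := Finset.univ.image g)
      (fun x _ => Finset.mem_image_of_mem g (Finset.mem_univ x))]
    refine Finset.sum_eq_zero fun c _ => ?_
    by_cases hc : c ∈ S
    -- On a single level, `v` is a scalar multiple of `u`.
    · have : ∑ x with g x = c, v x * f x =
          (v (r ⟨c, hc⟩) / u (r ⟨c, hc⟩)) * ∑ x with g x = c, u x * f x := by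
        rw [Finset.mul_sum]
        refine Finset.sum_congr rfl fun x hx => ?_
        rw [hval v hv x (r ⟨c, hc⟩) (hru _) ((Finset.mem_filter.1 hx).2.trans (hrg ⟨c, hc⟩).symm)]
        ring
      rw [this, hf c, mul_zero]
    · refine Finset.sum_eq_zero fun x hx => ?_
      have : v x = 0 := by
        by_contra hvx
        exact hc ((Finset.mem_filter.1 hx).2 ▸
          Finset.mem_image_of_mem _ (by simpa using hgen v hv x hvx))
      rw [this, zero_mul]
  · simp only [mul_sub, Finset.sum_sub_distrib, sum_mul_log_abs hE hu hv (hgen v hv), sub_self]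

end ExpFamily

/-! ### Sizes of the level sets. -/

section Counting

variable {X : Type*} [Fintype X]

/-- Bookkeeping of the excess over two points per level; the truncated subtraction is exact since
each level meets the support at least twice. -/
lemma sum_fiber_card_sub_two_add_two_mul_card {u g : X → ℝ}
    (h : ∀ c, ∑ x with g x = c, u x = 0) :
    ∑ c ∈ (Finset.univ.filter fun x => u x ≠ 0).image g,
        (((Finset.univ.filter fun x => u x ≠ 0).filter fun x => g x = c).card - 2) +
      2 * ((Finset.univ.filter fun x => u x ≠ 0).image g).card =
      (Finset.univ.filter fun x => u x ≠ 0).card := by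
  rw [Finset.card_eq_sum_card_image g (Finset.univ.filter fun x => u x ≠ 0), mul_comm,
    ← smul_eq_mul, ← Finset.sum_const, ← Finset.sum_add_distrib]
  exact Finset.sum_congr rfl fun c hc => Nat.sub_add_cancel (ExpFamily.two_le_card_fiber h hc)

/-- `hcard` permits a total excess of one. Three support points on a level consume it: the support
is then everything, the cardinality is odd, and no other level exceeds two points. -/
lemma fiber_card_cases {u g : X → ℝ}
    (h : ∀ c, ∑ x with g x = c, u x = 0)
    (hcard : Fintype.card X ≤ 2 * ((Finset.univ.filter fun x => u x ≠ 0).image g).card + 1)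
    {a b c : X} (ha : u a ≠ 0) (hb : u b ≠ 0) (hc : u c ≠ 0) (hab : g a = g b) (hac : g a = g c)
    (nab : a ≠ b) (nac : a ≠ c) (nbc : b ≠ c) :
    Odd (Fintype.card X) ∧ (∀ x, u x ≠ 0) ∧
      (Finset.univ.filter fun x => g x = g a).card = 3 ∧
      ∀ x y z, g x ≠ g a → g x = g y → g x = g z → x = y ∨ x = z ∨ y = z := by
  have h1 := sum_fiber_card_sub_two_add_two_mul_card h
  have h2 := Finset.card_le_univ (Finset.univ.filter fun x => u x ≠ 0)
  set X₀ := Finset.univ.filter fun x => u x ≠ 0 with hX₀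
  set e : ℝ → ℕ := fun c => (X₀.filter fun x => g x = c).card - 2 with he
  change ∑ c ∈ X₀.image g, e c + _ = _ at h1
  have key : ∀ x y z, u x ≠ 0 → u y ≠ 0 → u z ≠ 0 → g x = g y → g x = g z → x ≠ y → x ≠ z →
      y ≠ z → 1 ≤ e (g x) := by
    intro x y z hx hy hz hxy hxz nxy nxz nyz
    have : 2 < (X₀.filter fun t => g t = g x).card := by
      rw [Finset.two_lt_card]
      refine ⟨x, ?_, y, ?_, z, ?_, nxy, nxz, nyz⟩ <;> simp [X₀, hx, hy, hz, ← hxy, ← hxz]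
    simp only [he]
    omega
  have hea := key a b c ha hb hc hab hac nab nac nbc
  have hmem : ∀ x, u x ≠ 0 → g x ∈ X₀.image g := fun x hx =>
    Finset.mem_image_of_mem _ (by simpa [hX₀] using hx)
  have hle := Finset.single_le_sum (f := e) (fun _ _ => Nat.zero_le _) (hmem a ha)
  have hcard0 : X₀.card = Fintype.card X := by omega
  have huniv : X₀ = Finset.univ := Finset.card_eq_iff_eq_univ _ |>.1 hcard0
  have hne : ∀ x, u x ≠ 0 := fun x => by
    have : x ∈ X₀ := huniv ▸ Finset.mem_univ x
    simpa [hX₀] using this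
  refine ⟨⟨(X₀.image g).card, by omega⟩, hne, ?_, ?_⟩
  · have : e (g a) = 1 := by omega
    simp only [he, huniv] at this
    omega
  · intro x y z hxa hxy hxz
    by_contra! hcon
    have hex := key x y z (hne x) (hne y) (hne z) hxy hxz hcon.1 hcon.2.1 hcon.2.2
    have := Finset.sum_le_sum_of_subset (f := e) (s := {g x, g a}) (t := X₀.image g) (by
      intro t ht
      rcases Finset.mem_insert.1 ht with rfl | ht
      · exact hmem x (hne x)
      · exact Finset.mem_singleton.1 ht ▸ hmem a ha)
    rw [Finset.sum_pair hxa] at this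
    omega

/-- If the ground set is odd, the support pairs up except for a three-element set, which consists
of a single level set of `g` within the support of `u` and at most one further point. -/
lemma exists_exceptional_set {u g : X → ℝ}
    (h : ∀ c, ∑ x with g x = c, u x = 0)
    (hcard : Fintype.card X ≤ 2 * ((Finset.univ.filter fun x => u x ≠ 0).image g).card + 1)
    (hodd : Odd (Fintype.card X)) (h1 : Fintype.card X ≠ 1) :
    ∃ (Z : Finset X) (c : ℝ), Z.card = 3 ∧ (∃ x ∈ Z, u x ≠ 0) ∧ (∀ x ∈ Z, u x ≠ 0 → g x = c) ∧
      (∀ x ∉ Z, u x ≠ 0 ∧ g x ≠ c) ∧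
      ∀ x y z, x ∉ Z → y ∉ Z → z ∉ Z → g x = g y → g x = g z → x = y ∨ x = z ∨ y = z := by
  classical
  by_cases ht : ∃ a b c, u a ≠ 0 ∧ u b ≠ 0 ∧ u c ≠ 0 ∧ g a = g b ∧ g a = g c ∧
      a ≠ b ∧ a ≠ c ∧ b ≠ c
  · obtain ⟨a, b, c, ha, hb, hc, hab, hac, nab, nac, nbc⟩ := ht
    obtain ⟨-, hne, hZ, hout⟩ := fiber_card_cases h hcard ha hb hc hab hac nab nac nbc
    refine ⟨Finset.univ.filter fun x => g x = g a, g a, hZ, ⟨a, by simp, ha⟩, ?_, ?_, ?_⟩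
    · intro x hx _
      simpa using hx
    · intro x hx
      exact ⟨hne x, by simpa using hx⟩
    · intro x y z hx _ _
      exact hout x y z (by simpa using hx)
  · have h2 := sum_fiber_card_sub_two_add_two_mul_card h
    have h3 := Finset.card_le_univ (Finset.univ.filter fun x => u x ≠ 0)
    have h4 := Finset.card_compl (Finset.univ.filter fun x => u x ≠ 0)
    have htwo : ∀ c ∈ (Finset.univ.filter fun x => u x ≠ 0).image g,
        2 ≤ ((Finset.univ.filter fun x => u x ≠ 0).filter fun x => g x = c).card :=
      fun c hc => ExpFamily.two_le_card_fiber h hc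
    set X₀ := Finset.univ.filter fun x => u x ≠ 0 with hX₀
    have hle : ∀ c, (X₀.filter fun x => g x = c).card ≤ 2 := by
      intro c
      by_contra! hlt
      obtain ⟨x, hx, y, hy, z, hz, nxy, nxz, nyz⟩ := Finset.two_lt_card.1 hlt
      simp only [hX₀, Finset.mem_filter, Finset.mem_univ, true_and] at hx hy hz
      exact ht ⟨x, y, z, hx.1, hy.1, hz.1, hx.2.trans hy.2.symm, hx.2.trans hz.2.symm,
        nxy, nxz, nyz⟩
    rw [Finset.sum_eq_zero (fun c _ => Nat.sub_eq_zero_of_le (hle c)), zero_add] at h2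
    obtain ⟨n, hn⟩ := hodd
    -- Without triples the support has twice as many points as levels, so odd cardinality leaves
    -- exactly one point outside.
    have hcompl : X₀ᶜ.card = 1 := by omega
    obtain ⟨x₀, hx₀⟩ := Finset.card_eq_one.1 hcompl
    have hmem : ∀ x, u x = 0 ↔ x = x₀ := fun x => by
      rw [← Finset.mem_singleton (a := x₀), ← hx₀]
      simp [hX₀]
    -- Any pair may be joined to the point outside the support; one exists because `h1` excludes the
    -- one-point set.
    obtain ⟨c, hc⟩ : (X₀.image g).Nonempty := by
      rw [← Finset.card_pos]
      omega
    have hcc := le_antisymm (hle c) (htwo c hc)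
    have hnot : x₀ ∉ X₀.filter fun x => g x = c := by simp [hX₀, (hmem x₀).2 rfl]
    obtain ⟨a, ha, rfl⟩ := Finset.mem_image.1 hc
    have ha' : u a ≠ 0 := by simpa [hX₀] using ha
    refine ⟨insert x₀ (X₀.filter fun x => g x = g a), g a, ?_, ⟨a, by simp [ha], ha'⟩, ?_, ?_, ?_⟩
    · rw [Finset.card_insert_of_notMem hnot, hcc]
    · intro x hx hux
      rcases Finset.mem_insert.1 hx with rfl | hx
      · exact absurd ((hmem x).2 rfl) hux
      · exact (Finset.mem_filter.1 hx).2
    · intro x hx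
      simp only [Finset.mem_insert, Finset.mem_filter, not_or, not_and] at hx
      have hux : u x ≠ 0 := fun h => hx.1 ((hmem x).1 h)
      exact ⟨hux, hx.2 (by simpa [hX₀] using hux)⟩
    · intro x y z hx hy hz hxy hxz
      by_contra! hcon
      have hne : ∀ t, t ∉ insert x₀ (X₀.filter fun x => g x = g a) → u t ≠ 0 := fun t ht h =>
        ht (Finset.mem_insert.2 (Or.inl ((hmem t).1 h)))
      exact ht ⟨x, y, z, hne x hx, hne y hy, hne z hz, hxy, hxz, hcon.1, hcon.2.1, hcon.2.2⟩

end Counting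

/-- Two of three nonzero reals share a sign, and the third is minus their sum; strict
superadditivity of `t log t` on positive numbers gives the contradiction. -/
lemma log_abs_triple_false {a b c : ℝ} (ha : a ≠ 0) (hb : b ≠ 0) (hc : c ≠ 0)
    (h0 : a + b + c = 0)
    (h : a * Real.log |a| + b * Real.log |b| + c * Real.log |c| = 0) : False := by
  have key : ∀ x y : ℝ, 0 < x → 0 < y →
      x * Real.log x + y * Real.log y < (x + y) * Real.log (x + y) := by
    intro x y hx hy
    have h1 := Real.log_lt_log hx (show x < x + y by linarith)
    have h2 := Real.log_lt_log hy (show y < x + y by linarith)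
    nlinarith [mul_lt_mul_of_pos_left h1 hx, mul_lt_mul_of_pos_left h2 hy]
  have key' : ∀ x y z : ℝ, 0 < x * y → x + y + z = 0 →
      x * Real.log x + y * Real.log y + z * Real.log z ≠ 0 := by
    intro x y z hxy hz hl
    obtain rfl : z = -(x + y) := by linarith
    rw [Real.log_neg_eq_log] at hl
    rcases pos_and_pos_or_neg_and_neg_of_mul_pos hxy with ⟨hx, hy⟩ | ⟨hx, hy⟩
    · linarith [key x y hx hy]
    · have := key (-x) (-y) (neg_pos.2 hx) (neg_pos.2 hy)
      rw [← neg_add, Real.log_neg_eq_log, Real.log_neg_eq_log, Real.log_neg_eq_log] at this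
      linarith
  simp only [Real.log_abs] at h
  have hprod : 0 < a * b ∨ 0 < a * c ∨ 0 < b * c := by
    rcases lt_or_gt_of_ne ha with ha | ha <;> rcases lt_or_gt_of_ne hb with hb | hb <;>
      rcases lt_or_gt_of_ne hc with hc | hc <;>
      simp [mul_pos_of_neg_of_neg, *]
  rcases hprod with hp | hp | hp
  · exact key' a b c hp h0 h
  · exact key' a c b hp (by linarith) (by linarith)
  · exact key' b c a hp (by linarith) (by linarith)

/-! ### Recognizing partition families. -/

namespace ExpFamily

variable {X : Type*} [Fintype X] {E : ExpFamily X}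

/-- The reference measure matters only up to factors `exp θ` with `θ ∈ T`. -/
lemma carrier_congr {F : ExpFamily X} (hT : E.T = F.T)
    (hν : (fun x => Real.log (E.ν x) - Real.log (F.ν x)) ∈ E.T) : E.carrier = F.carrier := by
  rcases isEmpty_or_nonempty X with hX | hX
  · ext P
    exact ⟨fun _ => ⟨0, zero_mem _, Subsingleton.elim _ _⟩,
      fun _ => ⟨0, zero_mem _, Subsingleton.elim _ _⟩⟩
  · ext Q
    rw [mem_carrier_iff, mem_carrier_iff, ← hT]
    refine and_congr_right fun _ => and_congr_right fun _ => ⟨fun h => ?_, fun h => ?_⟩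
    · convert add_mem h hν using 1
      ext x
      simp
    · convert sub_mem h hν using 1
      ext x
      simp

/-- A family whose tangent space is cut out by the relations of a matching is a partition
family. -/
lemma exists_carrier_eq_partitionFamily {u g : X → ℝ}
    (hT : ∀ f, f ∈ E.T ↔ ∀ c, ∑ x with g x = c, u x * f x = 0)
    (hν : (fun x => Real.log |u x| - Real.log (E.ν x)) ∈ E.T)
    (hpair : ∀ x y z, u x ≠ 0 → u y ≠ 0 → u z ≠ 0 → g x = g y → g x = g z →
      x = y ∨ x = z ∨ y = z) :
    ∃ s : Setoid X, E.carrier = (partitionFamily s).carrier := by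
  classical
  -- Blocks are the levels inside the support of `u`; points outside it become singletons.
  let s : Setoid X :=
    { r := fun x y => x = y ∨ (u x ≠ 0 ∧ u y ≠ 0 ∧ g x = g y)
      iseqv := by
        refine ⟨fun x => Or.inl rfl, ?_, ?_⟩
        · rintro x y (h | h)
          · exact Or.inl h.symm
          · exact Or.inr ⟨h.2.1, h.1, h.2.2.symm⟩
        · rintro x y z (rfl | h) (rfl | h')
          · exact Or.inl rfl
          · exact Or.inr h'
          · exact Or.inr h
          · exact Or.inr ⟨h.1, h'.2.1, h.2.2.trans h'.2.2⟩ }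
  have hone : ∀ c, ∑ x with g x = c, u x = 0 := by
    simpa using (hT 1).1 E.one_mem
  have hsum : ∀ f : X → ℝ, ∀ x y, x ≠ y → u x ≠ 0 → u y ≠ 0 → g x = g y →
      ∑ z with g z = g x, u z * f z = u x * f x + u y * f y := by
    intro f x y hne hx hy hxy
    rw [← Finset.sum_pair (f := fun z => u z * f z) hne]
    symm
    refine Finset.sum_subset ?_ ?_
    · intro z hz
      rcases Finset.mem_insert.1 hz with rfl | hz
      · simp
      · simp [Finset.mem_singleton.1 hz, hxy]
    · intro z hz hz'
      simp only [Finset.mem_insert, Finset.mem_singleton, not_or] at hz'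
      by_contra h
      rcases hpair x y z hx hy (left_ne_zero_of_mul h) hxy
        (Finset.mem_filter.1 hz).2.symm with h | h | h
      · exact hne h
      · exact hz'.1 h.symm
      · exact hz'.2 h.symm
  -- The relation for the constant function 1 makes the two values on a pair opposite.
  have hneg : ∀ x y, x ≠ y → u x ≠ 0 → u y ≠ 0 → g x = g y → u x = -u y := by
    intro x y hne hx hy hxy
    have := hsum 1 x y hne hx hy hxy
    simp only [Pi.one_apply, mul_one, hone] at this
    linarith
  have hTs : E.T = (partitionFamily s).T := by
    ext f
    rw [hT]
    constructor
    · rintro hf x y (rfl | ⟨hx, hy, hxy⟩)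
      · rfl
      by_cases hne : x = y
      · rw [hne]
      have h1 := hsum f x y hne hx hy hxy
      rw [hf, hneg x y hne hx hy hxy] at h1
      have h2 : u y * (f y - f x) = 0 := by linarith
      linarith [(mul_eq_zero.1 h2).resolve_left hy]
    · intro hf c
      by_cases hc : ∃ x, u x ≠ 0 ∧ g x = c
      · obtain ⟨x, hx, rfl⟩ := hc
        have : ∑ y with g y = g x, u y * f y = (∑ y with g y = g x, u y) * f x := by
          rw [Finset.sum_mul]
          refine Finset.sum_congr rfl fun y hy => ?_
          by_cases huy : u y = 0
          · simp [huy]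
          · rw [hf x y (Or.inr ⟨hx, huy, ((Finset.mem_filter.1 hy).2).symm⟩)]
        rw [this, hone, zero_mul]
      · push Not at hc
        refine Finset.sum_eq_zero fun x hx => ?_
        have : u x = 0 := by
          by_contra h
          exact hc x h (Finset.mem_filter.1 hx).2
        rw [this, zero_mul]
  refine ⟨s, carrier_congr hTs ?_⟩
  -- Since `|u|` is constant on pairs, `log |u|` lies in `T`; with `hν` so does `log ν`, and `ν` may
  -- be replaced by 1.
  have habs : (fun x => Real.log |u x|) ∈ E.T := by
    rw [hTs]
    rintro x y (rfl | ⟨hx, hy, hxy⟩)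
    · rfl
    by_cases hne : x = y
    · rw [hne]
    · simp only [hneg x y hne hx hy hxy, abs_neg]
  convert sub_mem habs hν using 1
  ext x
  simp [partitionFamily]

end ExpFamily

/-! ### Extension by zero, restriction to subsets, and mixtures. -/

section Extend

variable {X : Type*} {Y : Finset X}

lemma extend_val_apply (P : Y → ℝ) (y : Y) :
    Function.extend (Subtype.val : Y → X) P 0 y = P y :=
  Subtype.val_injective.extend_apply P 0 y

lemma extend_val_of_notMem (P : Y → ℝ) {x : X} (hx : x ∉ Y) :
    Function.extend (Subtype.val : Y → X) P 0 x = 0 := by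
  rw [Function.extend_apply']
  · rfl
  · rintro ⟨y, rfl⟩
    exact hx y.2

lemma continuous_extend_val :
    Continuous fun P : Y → ℝ => Function.extend (Subtype.val : Y → X) P 0 := by
  refine continuous_pi fun x => ?_
  by_cases hx : x ∈ Y
  · simpa only [extend_val_apply _ (⟨x, hx⟩ : Y)] using continuous_apply (⟨x, hx⟩ : Y)
  · simpa only [extend_val_of_notMem _ hx] using continuous_const

lemma sum_eq_sum_coe_sort [Fintype X] {F : X → ℝ} (hF : ∀ x ∉ Y, F x = 0) :
    ∑ x, F x = ∑ y : Y, F y := by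
  rw [Finset.sum_coe_sort Y F]
  exact (Finset.sum_subset (Finset.subset_univ Y) fun x _ hx => hF x hx).symm

end Extend

namespace ExpFamily

/-- The family of the distributions of an exponential family conditioned on a subset. -/
def restrict {X : Type*} (E : ExpFamily X) (Y : Finset X) : ExpFamily Y where
  ν := fun y => E.ν y
  ν_pos := fun y => E.ν_pos y
  T := E.T.map (LinearMap.funLeft ℝ ℝ (Subtype.val : Y → X))
  one_mem := ⟨1, E.one_mem, rfl⟩

variable {X : Type*} {E : ExpFamily X}

lemma comp_val_mem_restrict {f : X → ℝ} (hf : f ∈ E.T) (Y : Finset X) :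
    (fun y : Y => f y) ∈ (E.restrict Y).T :=
  ⟨f, hf, rfl⟩

lemma normalize_mem_carrier_restrict {Q : X → ℝ} {Y : Finset X} [Nonempty Y]
    (hpos : ∀ x, 0 < Q x)
    (hQ : (fun y : Y => Real.log (Q y) - Real.log (E.ν y)) ∈ (E.restrict Y).T) :
    (fun y : Y => Q y / ∑ z : Y, Q z) ∈ (E.restrict Y).carrier := by
  have hq : 0 < ∑ z : Y, Q z := Finset.sum_pos (fun z _ => hpos z) Finset.univ_nonempty
  refine mem_carrier_of_log_sub_log_mem (fun y => div_pos (hpos y) hq) ?_ ?_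
  · rw [← Finset.sum_div, div_self hq.ne']
  · convert sub_mem hQ ((E.restrict Y).T.smul_mem (Real.log (∑ z : Y, Q z))
      (E.restrict Y).one_mem) using 1
    ext y
    simp only [restrict, Pi.sub_apply, Pi.smul_apply, Pi.one_apply, smul_eq_mul]
    rw [Real.log_div (hpos y).ne' hq.ne']
    ring

variable [Fintype X]

/-- Conditioning `Q` on `Y` divides it by `Q(Y) ≤ 1`, which can only lower the divergence from a `P`
living on `Y`. -/
lemma infoDivFrom_restrict_le (Y : Finset X) {P : Y → ℝ} (hP : P ∈ stdSimplex ℝ Y) :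
    infoDivFrom (E.restrict Y).carrier P ≤
      infoDivFrom E.carrier (Function.extend (Subtype.val : Y → X) P 0) := by
  have hne : Nonempty Y := by
    by_contra h
    rw [not_nonempty_iff] at h
    simpa using hP.2
  refine le_iInf₂ fun Q hQ => ?_
  have hpos := pos_of_mem_carrier hQ
  have hmem := normalize_mem_carrier_restrict (Y := Y) hpos
    (comp_val_mem_restrict (log_sub_log_mem hQ) Y)
  refine iInf₂_le_of_le _ hmem ?_
  rw [infoDiv_eq_relEnt (pos_of_mem_carrier hmem), infoDiv_eq_relEnt hpos, EReal.coe_le_coe_iff,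
    relEnt, relEnt, sum_eq_sum_coe_sort (Y := Y)
      fun x hx => by rw [extend_val_of_notMem _ hx, zero_mul]]
  simp only [extend_val_apply]
  have : Nonempty X := hne.map Subtype.val
  have hq : 0 < ∑ z : Y, Q z := Finset.sum_pos (fun z _ => hpos z) Finset.univ_nonempty
  have hq1 : ∑ z : Y, Q z ≤ 1 := by
    rw [← sum_of_mem_carrier hQ, Finset.sum_coe_sort Y Q]
    exact Finset.sum_le_univ_sum_of_nonneg fun x => (hpos x).le
  refine Finset.sum_le_sum fun y _ => ?_
  rcases (hP.1 y).eq_or_lt with h0 | h0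
  · simp [← h0]
  · refine mul_le_mul_of_nonneg_left (Real.log_le_log ?_ ?_) h0.le
    · exact div_pos h0 (div_pos (hpos y) hq)
    · exact div_le_div_of_nonneg_left h0.le (hpos y) (le_div_self (hpos y).le hq hq1)

lemma extend_mem_stdSimplex {Y : Finset X} {P : Y → ℝ} (hP : P ∈ stdSimplex ℝ Y) :
    Function.extend (Subtype.val : Y → X) P 0 ∈ stdSimplex ℝ X := by
  refine ⟨fun x => ?_, ?_⟩
  · by_cases hx : x ∈ Y
    · exact (hP.1 ⟨x, hx⟩).trans_eq (extend_val_apply P ⟨x, hx⟩).symm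
    · rw [extend_val_of_notMem _ hx]
  · rw [sum_eq_sum_coe_sort (Y := Y) fun x hx => extend_val_of_notMem _ hx]
    simpa only [extend_val_apply] using hP.2

lemma infoDivFrom_restrict_le_log_two
    (hE : ∀ P ∈ stdSimplex ℝ X, infoDivFrom E.carrier P ≤ (Real.log 2 : EReal)) (Y : Finset X) :
    ∀ P ∈ stdSimplex ℝ Y, infoDivFrom (E.restrict Y).carrier P ≤ (Real.log 2 : EReal) :=
  fun _ hP => (infoDivFrom_restrict_le Y hP).trans (hE _ (extend_mem_stdSimplex hP))

section Labelling

variable {u g : X → ℝ}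

/-- `hY` says that no level within the support of `u` is cut by `Y`, so each relation lives inside
`Y` or outside it. For the converse direction, extend by zero. -/
lemma mem_restrict_T_iff (hT : ∀ f, f ∈ E.T ↔ ∀ c, ∑ x with g x = c, u x * f x = 0)
    {Y : Finset X} (hY : ∀ x ∈ Y, ∀ y, u x ≠ 0 → u y ≠ 0 → g x = g y → y ∈ Y) (f : Y → ℝ) :
    f ∈ (E.restrict Y).T ↔ ∀ c, ∑ y ∈ Finset.univ.filter (fun y : Y => g y = c), u y * f y = 0 := by
  constructor
  · rintro ⟨F, hF, rfl⟩ c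
    by_cases hc : ∃ y : Y, u y ≠ 0 ∧ g y = c
    · obtain ⟨y, hy, rfl⟩ := hc
      rw [← (hT F).1 hF (g y), Finset.sum_filter, Finset.sum_filter,
        sum_eq_sum_coe_sort (Y := Y) (F := fun x => if g x = g y then u x * F x else 0)]
      · rfl
      · intro x hx
        split_ifs with hgx
        · have : u x = 0 := by
            by_contra hux
            exact hx (hY y y.2 x hy hux hgx.symm)
          rw [this, zero_mul]
        · rfl
    · push Not at hc
      refine Finset.sum_eq_zero fun y hy => ?_
      have : u y = 0 := by
        by_contra h
        exact hc y h (Finset.mem_filter.1 hy).2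
      rw [this, zero_mul]
  · intro hf
    refine ⟨Function.extend Subtype.val f 0, (hT _).2 fun c => ?_, ?_⟩
    · rw [← hf c, Finset.sum_filter, Finset.sum_filter, sum_eq_sum_coe_sort (Y := Y)]
      · simp only [extend_val_apply]
      · intro x hx
        simp [extend_val_of_notMem _ hx]
    · ext y
      exact extend_val_apply f y

lemma mem_T_iff_restrict [DecidableEq X]
    (hT : ∀ f, f ∈ E.T ↔ ∀ c, ∑ x with g x = c, u x * f x = 0)
    {Z : Finset X} (hZ : ∀ x ∈ Z, ∀ y, u x ≠ 0 → u y ≠ 0 → g x = g y → y ∈ Z) (f : X → ℝ) :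
    f ∈ E.T ↔ (fun y : (Zᶜ : Finset X) => f y) ∈ (E.restrict Zᶜ).T ∧
      (fun z : Z => f z) ∈ (E.restrict Z).T := by
  refine ⟨fun hf => ⟨comp_val_mem_restrict hf _, comp_val_mem_restrict hf _⟩, ?_⟩
  have hZc : ∀ x ∈ Zᶜ, ∀ y, u x ≠ 0 → u y ≠ 0 → g x = g y → y ∈ Zᶜ := by
    intro x hx y hux huy hxy
    rw [Finset.mem_compl] at hx ⊢
    exact fun hy => hx (hZ y hy x huy hux hxy.symm)
  rintro ⟨h1, h2⟩
  rw [mem_restrict_T_iff hT hZc] at h1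
  rw [mem_restrict_T_iff hT hZ] at h2
  refine (hT f).2 fun c => ?_
  have e1 := h1 c
  have e2 := h2 c
  rw [Finset.sum_filter] at e1 e2 ⊢
  rw [Finset.sum_coe_sort Zᶜ (fun x => if g x = c then u x * f x else 0)] at e1
  rw [Finset.sum_coe_sort Z (fun x => if g x = c then u x * f x else 0)] at e2
  rw [← Finset.sum_add_sum_compl Z, e1, e2, add_zero]

lemma mem_normalSpace_of_labelling (hT : ∀ f, f ∈ E.T ↔ ∀ c, ∑ x with g x = c, u x * f x = 0)
    (c : ℝ) : (fun x => if g x = c then u x else 0) ∈ E.normalSpace := by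
  refine mem_normalSpace.2 fun f hf => ?_
  refine Eq.trans ?_ ((hT f).1 hf c)
  rw [Finset.sum_filter]
  exact Finset.sum_congr rfl fun x _ => by rw [ite_mul, zero_mul]

lemma maxInfoDivEq_of_labelling
    (hE : ∀ P ∈ stdSimplex ℝ X, infoDivFrom E.carrier P ≤ (Real.log 2 : EReal))
    (hT : ∀ f, f ∈ E.T ↔ ∀ c, ∑ x with g x = c, u x * f x = 0) {x : X} (hx : u x ≠ 0) :
    MaxInfoDivEq E.carrier (Real.log 2) :=
  maxInfoDivEq_log_two hE (mem_normalSpace_of_labelling hT (g x))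
    fun h => hx (by simpa using congrFun h x)

/-- Only one relation is nontrivial, so `T` is the kernel of a nonzero functional on a
three-dimensional space. -/
lemma dim_eq_one_of_labelling (hT : ∀ f, f ∈ E.T ↔ ∀ c, ∑ x with g x = c, u x * f x = 0)
    (hcard : Fintype.card X = 3) {x : X} (hx : u x ≠ 0) {c : ℝ}
    (hc : ∀ y, u y ≠ 0 → g y = c) : E.dim = 1 := by
  let φ : Module.Dual ℝ (X → ℝ) := dotProductBilin ℝ ℝ u
  have hφ : ∀ f, φ f = ∑ y, u y * f y := fun f => rfl
  have hφ0 : φ ≠ 0 := by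
    classical
    intro h
    have := congrArg (fun ψ => ψ (Pi.single x 1)) h
    simp [hφ, Pi.single_apply, hx] at this
  have hTφ : E.T = LinearMap.ker φ := by
    ext f
    rw [hT, LinearMap.mem_ker, hφ]
    have hfull : ∑ y with g y = c, u y * f y = ∑ y, u y * f y := by
      rw [Finset.sum_filter]
      refine Finset.sum_congr rfl fun y _ => ?_
      by_cases hy : u y = 0
      · simp [hy]
      · rw [if_pos (hc y hy)]
    refine ⟨fun h => hfull ▸ h c, fun h d => ?_⟩
    by_cases hd : d = c
    · rw [hd, hfull, h]
    · refine Finset.sum_eq_zero fun y hy => ?_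
      have : u y = 0 := by
        by_contra huy
        exact hd ((Finset.mem_filter.1 hy).2.symm.trans (hc y huy))
      rw [this, zero_mul]
  have := Module.Dual.finrank_ker_add_one_of_ne_zero hφ0
  rw [Module.finrank_pi, hcard] at this
  rw [dim, hTφ]
  omega

end Labelling

lemma isCompact_closure_carrier : IsCompact (closure E.carrier) := by
  rcases isEmpty_or_nonempty X with hX | hX
  · exact (Set.toFinite _).isCompact
  · refine (isCompact_stdSimplex ℝ X).of_isClosed_subset isClosed_closure
      (closure_minimal (fun Q hQ => ?_) (isClosed_stdSimplex ℝ X))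
    exact ⟨fun x => (pos_of_mem_carrier hQ x).le, sum_of_mem_carrier hQ⟩

/-- Since `T` splits along `Z` and `Zᶜ`, the family consists of all `l p + (1 - l) q` with `0 < l <
1` and `p`, `q` in the restricted families. By compactness, closure commutes with this continuous
parametrization and turns the open interval into the closed one. -/
lemma closure_carrier_eq_mixture [DecidableEq X] {Z : Finset X} (hZ : Z.Nonempty)
    (hZc : (Zᶜ : Finset X).Nonempty)
    (hT : ∀ f, f ∈ E.T ↔ (fun y : (Zᶜ : Finset X) => f y) ∈ (E.restrict Zᶜ).T ∧
      (fun z : Z => f z) ∈ (E.restrict Z).T) :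
    closure E.carrier = mixture ![extendByZero (closure (E.restrict Zᶜ).carrier),
      extendByZero (closure (E.restrict Z).carrier)] := by
  have hX : Nonempty X := ⟨hZ.choose⟩
  have hZ' : Nonempty Z := hZ.to_subtype
  have hZc' : Nonempty (Zᶜ : Finset X) := hZc.to_subtype
  let Φ : ℝ × ((Zᶜ : Finset X) → ℝ) × (Z → ℝ) → X → ℝ := fun p =>
    p.1 • Function.extend Subtype.val p.2.1 0 + (1 - p.1) • Function.extend Subtype.val p.2.2 0
  have hΦ : Continuous Φ := by
    have h1 := (continuous_extend_val (Y := Zᶜ)).comp (continuous_fst.comp continuous_snd :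
      Continuous fun p : ℝ × ((Zᶜ : Finset X) → ℝ) × (Z → ℝ) => p.2.1)
    have h2 := (continuous_extend_val (Y := Z)).comp (continuous_snd.comp continuous_snd :
      Continuous fun p : ℝ × ((Zᶜ : Finset X) → ℝ) × (Z → ℝ) => p.2.2)
    exact (continuous_fst.smul h1).add ((continuous_const.sub continuous_fst).smul h2)
  have hΦc : ∀ (l : ℝ) p q (y : (Zᶜ : Finset X)), Φ (l, p, q) y = l * p y := by
    intro l p q y
    simp only [Φ, Pi.add_apply, Pi.smul_apply, smul_eq_mul, extend_val_apply,
      extend_val_of_notMem _ (Finset.mem_compl.1 y.2), mul_zero, add_zero]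
  have hΦz : ∀ (l : ℝ) p q (z : Z), Φ (l, p, q) z = (1 - l) * q z := by
    intro l p q z
    have : (z : X) ∉ Zᶜ := by simp
    simp only [Φ, Pi.add_apply, Pi.smul_apply, smul_eq_mul, extend_val_apply,
      extend_val_of_notMem _ this, mul_zero, zero_add]
  have hcases : ∀ p : X → Prop, (∀ y : (Zᶜ : Finset X), p y) → (∀ z : Z, p z) → ∀ x, p x := by
    intro p h1 h2 x
    by_cases hx : x ∈ Z
    · exact h2 ⟨x, hx⟩
    · exact h1 ⟨x, Finset.mem_compl.2 hx⟩
  have hsplit : ∀ Q : X → ℝ, ∑ x, Q x = ∑ y : (Zᶜ : Finset X), Q y + ∑ z : Z, Q z := by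
    intro Q
    rw [Finset.sum_coe_sort Zᶜ Q, Finset.sum_coe_sort Z Q, add_comm, Finset.sum_add_sum_compl]
  have himage : E.carrier =
      Φ '' (Set.Ioo 0 1 ×ˢ (E.restrict Zᶜ).carrier ×ˢ (E.restrict Z).carrier) := by
    ext Q
    constructor
    · intro hQ
      have hpos := pos_of_mem_carrier hQ
      have hsum := sum_of_mem_carrier hQ
      rw [hsplit] at hsum
      have hc : 0 < ∑ y : (Zᶜ : Finset X), Q y :=
        Finset.sum_pos (fun z _ => hpos z) Finset.univ_nonempty
      have hz : 0 < ∑ z : Z, Q z := Finset.sum_pos (fun z _ => hpos z) Finset.univ_nonempty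
      have hmem := (hT _).1 (log_sub_log_mem hQ)
      refine ⟨(∑ y : (Zᶜ : Finset X), Q y, fun y => Q y / ∑ y : (Zᶜ : Finset X), Q y,
        fun z => Q z / ∑ z : Z, Q z), ⟨⟨hc, by linarith⟩,
          normalize_mem_carrier_restrict hpos hmem.1,
          normalize_mem_carrier_restrict hpos hmem.2⟩, funext (hcases _ (fun y => ?_) fun z => ?_)⟩
      · rw [hΦc, mul_div_cancel₀ _ hc.ne']
      · rw [hΦz, ← hsum, add_sub_cancel_left, mul_div_cancel₀ _ hz.ne']
    · rintro ⟨⟨l, p, q⟩, ⟨⟨hl0, hl1⟩, hp, hq⟩, rfl⟩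
      have hl1' := sub_pos.2 hl1
      refine mem_carrier_of_log_sub_log_mem (hcases _ (fun y => ?_) fun z => ?_) ?_
        ((hT _).2 ⟨?_, ?_⟩)
      · rw [hΦc]
        exact mul_pos hl0 (pos_of_mem_carrier hp y)
      · rw [hΦz]
        exact mul_pos hl1' (pos_of_mem_carrier hq z)
      · simp only [hsplit, hΦc, hΦz]
        rw [← Finset.mul_sum, ← Finset.mul_sum, sum_of_mem_carrier hp, sum_of_mem_carrier hq]
        ring
      · convert add_mem (log_sub_log_mem hp) ((E.restrict Zᶜ).T.smul_mem (Real.log l)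
          (E.restrict Zᶜ).one_mem) using 1
        ext y
        rw [hΦc, Real.log_mul hl0.ne' (pos_of_mem_carrier hp y).ne']
        simp only [restrict, Pi.add_apply, Pi.smul_apply, Pi.one_apply, smul_eq_mul]
        ring
      · convert add_mem (log_sub_log_mem hq) ((E.restrict Z).T.smul_mem (Real.log (1 - l))
          (E.restrict Z).one_mem) using 1
        ext z
        rw [hΦz, Real.log_mul hl1'.ne' (pos_of_mem_carrier hq z).ne']
        simp only [restrict, Pi.add_apply, Pi.smul_apply, Pi.one_apply, smul_eq_mul]
        ring
  have hcl : closure (Set.Ioo (0 : ℝ) 1 ×ˢ (E.restrict Zᶜ).carrier ×ˢ (E.restrict Z).carrier) =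
      Set.Icc 0 1 ×ˢ closure (E.restrict Zᶜ).carrier ×ˢ closure (E.restrict Z).carrier := by
    rw [closure_prod_eq, closure_prod_eq, closure_Ioo zero_ne_one]
  rw [himage, ← image_closure_of_isCompact _ hΦ.continuousOn, hcl]
  · ext Q
    constructor
    · rintro ⟨⟨l, p, q⟩, ⟨⟨hl0, hl1⟩, hp, hq⟩, rfl⟩
      refine ⟨![l, 1 - l], ![Function.extend Subtype.val p 0, Function.extend Subtype.val q 0],
        ?_, by simp, ?_, by simp [Φ]⟩
      · simp [Fin.forall_fin_two, hl0, hl1]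
      · rw [Fin.forall_fin_two]
        exact ⟨⟨p, hp, rfl⟩, ⟨q, hq, rfl⟩⟩
    · rintro ⟨w, R, hw, hw1, hR, rfl⟩
      rw [Fin.sum_univ_two] at hw1
      obtain ⟨p, hp, hp'⟩ := hR 0
      obtain ⟨q, hq, hq'⟩ := hR 1
      refine ⟨(w 0, p, q), ⟨⟨hw 0, by linarith [hw 1]⟩, hp, hq⟩, ?_⟩
      rw [Fin.sum_univ_two, ← hp', ← hq', eq_sub_of_add_eq' hw1]
  · rw [hcl]
    exact isCompact_Icc.prod (isCompact_closure_carrier.prod isCompact_closure_carrier)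

lemma closure_carrier_eq_extendByZero {Z : Finset X} (hZ : Z = Finset.univ) :
    closure E.carrier = extendByZero (closure (E.restrict Z).carrier) := by
  subst hZ
  rw [extendByZero, image_closure_of_isCompact isCompact_closure_carrier
    continuous_extend_val.continuousOn]
  congr 1
  have hext : ∀ (P : {x // x ∈ (Finset.univ : Finset X)} → ℝ) x,
      Function.extend Subtype.val P 0 x =
        P ⟨x, Finset.mem_univ x⟩ := fun P x => extend_val_apply P ⟨x, Finset.mem_univ x⟩
  ext Q
  constructor
  · rintro ⟨θ, hθ, rfl⟩
    refine ⟨_, ⟨_, comp_val_mem_restrict hθ _, rfl⟩, ?_⟩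
    ext x
    refine (hext _ x).trans ?_
    rw [← Finset.sum_coe_sort Finset.univ (fun y => E.ν y * Real.exp (θ y))]
    rfl
  · rintro ⟨_, ⟨_, ⟨θ, hθ, rfl⟩, rfl⟩, rfl⟩
    refine ⟨θ, hθ, ?_⟩
    ext x
    rw [← Finset.sum_coe_sort Finset.univ (fun y => E.ν y * Real.exp (θ y))]
    exact hext _ x

/-- On a single point every divergence from the family vanishes. This removes the one case of odd
cardinality with no room for a three-element `Z`. -/
lemma card_ne_one (hmax : MaxInfoDivEq E.carrier (Real.log 2)) : Fintype.card X ≠ 1 := by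
  intro h1
  obtain ⟨⟨P, hP, hval⟩, -⟩ := hmax
  obtain ⟨x, hx⟩ := Fintype.card_eq_one_iff.1 h1
  have huniv : (Finset.univ : Finset X) = {x} := by
    ext y
    simp [hx y]
  have : Nonempty X := ⟨x⟩
  obtain ⟨Q, hQ⟩ : E.carrier.Nonempty := ⟨_, 0, zero_mem _, rfl⟩
  have hle : infoDivFrom E.carrier P ≤ _ := iInf₂_le _ hQ
  have hP1 := hP.2
  have hQ1 := sum_of_mem_carrier hQ
  rw [hval, infoDiv_eq_relEnt (pos_of_mem_carrier hQ), EReal.coe_le_coe_iff, relEnt] at hle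
  rw [huniv, Finset.sum_singleton] at hP1 hle
  rw [Finset.sum_eq_single x (fun y _ hy => absurd (hx y) hy) (by simp)] at hQ1
  rw [hP1, hQ1] at hle
  simp only [div_one, Real.log_one, mul_zero] at hle
  exact absurd hle (not_le.2 (Real.log_pos one_lt_two))

/-- The dimension of `T` is the rounded-up half of the cardinality, so the normal space gets the
rounded-down half. -/
lemma card_le_of_dim_eq (hdim : E.dim = ⌈(Fintype.card X : ℚ) / 2⌉ - 1) :
    Fintype.card X ≤ 2 * Module.finrank ℝ E.normalSpace + 1 := by
  have h1 : (Module.finrank ℝ E.T : ℤ) = ⌈(Fintype.card X : ℚ) / 2⌉ := by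
    rw [dim] at hdim
    linarith
  have h2 := Int.ceil_lt_add_one ((Fintype.card X : ℚ) / 2)
  rw [← h1] at h2
  have h3 : 2 * (Module.finrank ℝ E.T : ℚ) < Fintype.card X + 2 := by
    push_cast at h2
    linarith
  have h4 : 2 * Module.finrank ℝ E.T < Fintype.card X + 2 := by exact_mod_cast h3
  rw [finrank_normalSpace]
  omega

end ExpFamily

/-! ### The main theorem. -/

open ExpFamily in
theorem mainTheorem3 {X : Type*} [Fintype X] [DecidableEq X] (E : ExpFamily X)
    (hdim : E.dim = ⌈(Fintype.card X : ℚ) / 2⌉ - 1)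
    (hmax : MaxInfoDivEq E.carrier (Real.log 2)) :
    (Even (Fintype.card X) →
      ∃ s : Setoid X, E.carrier = (partitionFamily s).carrier ∧
        closure E.carrier = partitionModel s) ∧
    (Odd (Fintype.card X) →
      ∃ Z : Finset X, Z.card = 3 ∧
        ∃ EZ : ExpFamily Z, EZ.dim = 1 ∧ MaxInfoDivEq EZ.carrier (Real.log 2) ∧
          (Fintype.card X = 3 → closure E.carrier = extendByZero (closure EZ.carrier)) ∧
          (3 < Fintype.card X →
            ∃ s : Setoid (Zᶜ : Finset X),
              MaxInfoDivEq (partitionFamily s).carrier (Real.log 2) ∧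
              closure E.carrier =
                mixture ![extendByZero (partitionModel s), extendByZero (closure EZ.carrier)])) ∧
    ((fun _ : X => (1 : ℝ) / Fintype.card X) ∈ E.carrier →
      ∃ s : Setoid X, closure E.carrier = partitionModel s) := by
  have hE : ∀ P ∈ stdSimplex ℝ X, infoDivFrom E.carrier P ≤ (Real.log 2 : EReal) :=
    fun P hP => hmax.2 ⟨P, hP, rfl⟩
  obtain ⟨u, g, hT, hν, hcard⟩ := exists_labelling hE (card_le_of_dim_eq hdim)
  have hfib : ∀ c, ∑ x with g x = c, u x = 0 := by
    simpa using (hT 1).1 E.one_mem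
  refine ⟨fun heven => ?_, fun hodd => ?_, fun hunif => ?_⟩
  · obtain ⟨s, hs⟩ := exists_carrier_eq_partitionFamily hT hν fun x y z hx hy hz hxy hxz => by
      by_contra! hcon
      exact Nat.not_even_iff_odd.2 (fiber_card_cases hfib hcard hx hy hz hxy hxz hcon.1 hcon.2.1
        hcon.2.2).1 heven
    exact ⟨s, hs, by rw [hs, partitionModel]⟩
  · obtain ⟨Z, c, hZ3, ⟨x, hxZ, hx⟩, hZc, hout, hpair⟩ :=
      exists_exceptional_set hfib hcard hodd (card_ne_one hmax)
    have hsat : ∀ x ∈ Z, ∀ y, u x ≠ 0 → u y ≠ 0 → g x = g y → y ∈ Z := by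
      intro x hx y hux _ hxy
      by_contra hy
      exact (hout y hy).2 (hxy ▸ hZc x hx hux)
    have hTZ := mem_restrict_T_iff hT hsat
    refine ⟨Z, hZ3, E.restrict Z, ?_, ?_, ?_, ?_⟩
    · exact dim_eq_one_of_labelling (u := fun z : Z => u z) (g := fun z : Z => g z) hTZ
        (by simpa using hZ3) (x := ⟨x, hxZ⟩) hx (c := c) fun y => hZc y y.2
    · exact maxInfoDivEq_of_labelling (u := fun z : Z => u z) (g := fun z : Z => g z)
        (infoDivFrom_restrict_le_log_two hE Z) hTZ (x := ⟨x, hxZ⟩) hx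
    · exact fun h3 => closure_carrier_eq_extendByZero
        ((Finset.card_eq_iff_eq_univ Z).1 (hZ3.trans h3.symm))
    · intro hlt
      have hsatc : ∀ x ∈ Zᶜ, ∀ y, u x ≠ 0 → u y ≠ 0 → g x = g y → y ∈ Zᶜ := by
        intro x hx y hux huy hxy
        rw [Finset.mem_compl] at hx ⊢
        exact fun hy => hx (hsat y hy x huy hux hxy.symm)
      have hTY := mem_restrict_T_iff hT hsatc
      have hne : (Zᶜ : Finset X).Nonempty := by
        rw [← Finset.card_pos, Finset.card_compl]
        omega
      obtain ⟨y, hy⟩ := hne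
      obtain ⟨s, hs⟩ := exists_carrier_eq_partitionFamily (E := E.restrict Zᶜ)
        (u := fun y => u y) (g := fun y => g y) hTY (comp_val_mem_restrict hν _)
        (fun a b d _ _ _ hab had => by
          simpa only [Subtype.ext_iff] using hpair a b d (Finset.mem_compl.1 a.2)
            (Finset.mem_compl.1 b.2) (Finset.mem_compl.1 d.2) hab had)
      refine ⟨s, hs ▸ ?_, ?_⟩
      · exact maxInfoDivEq_of_labelling (u := fun y : (Zᶜ : Finset X) => u y)
          (g := fun y : (Zᶜ : Finset X) => g y) (infoDivFrom_restrict_le_log_two hE _) hTY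
          (x := ⟨y, hy⟩) (hout y (Finset.mem_compl.1 hy)).1
      · rw [partitionModel, ← hs]
        exact closure_carrier_eq_mixture ⟨x, hxZ⟩ ⟨y, hy⟩ (mem_T_iff_restrict hT hsat)
  · obtain ⟨s, hs⟩ := exists_carrier_eq_partitionFamily hT hν fun x y z hx hy hz hxy hxz => by
      by_contra! hcon
      have h3 := (fiber_card_cases hfib hcard hx hy hz hxy hxz hcon.1 hcon.2.1 hcon.2.2).2.2.1
      have hset : Finset.univ.filter (fun t => g t = g x) = {x, y, z} := by
        refine (Finset.eq_of_subset_of_card_le (fun t ht => ?_) ?_).symm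
        · simp only [Finset.mem_insert, Finset.mem_singleton] at ht
          rcases ht with rfl | rfl | rfl <;> simp [← hxy, ← hxz]
        · rw [h3, Finset.card_eq_three.2 ⟨x, y, z, hcon.1, hcon.2.1, hcon.2.2, rfl⟩]
      have hsum : ∀ f : X → ℝ, ∑ t with g t = g x, f t = f x + f y + f z := by
        intro f
        rw [hset, Finset.sum_insert (by simp [hcon.1, hcon.2.1]), Finset.sum_pair hcon.2.2,
          add_assoc]
      -- The uniform distribution in the family puts `log ν` in `T`, up to a constant; with `hν`
      -- this gives `log |u| ∈ T`, whose relation on the triple is the forbidden one.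
      have hlog : (fun x => Real.log |u x|) ∈ E.T := by
        convert add_mem (sub_mem hν (log_sub_log_mem hunif))
          (E.T.smul_mem (Real.log (1 / Fintype.card X)) E.one_mem) using 1
        ext t
        simp
      have e1 := hfib (g x)
      have e2 := (hT _).1 hlog (g x)
      rw [hsum] at e1 e2
      exact log_abs_triple_false hx hy hz e1 e2
    exact ⟨s, by rw [hs, partitionModel]⟩
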